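/- For $A,B\subseteq\mathbb{R}$ write $A\leq B$ if there is a continuous function $f\colon\mathbb{R}\to\mathbb{R}$ such that $x\in A\Leftrightarrow f(x)\in B$ for all $x\in\mathbb{R}$. Let ${\bf\Sigma}^0_\alpha$ and ${\bf\Pi}^0_\alpha$ ($1\leq\alpha<\omega_1$) denote the levels of the Borel hierarchy on $\mathbb{R}$: ${\bf\Sigma}^0_1$ consists of the open sets, ${\bf\Pi}^0_\alpha$ of the complements of ${\bf\Sigma}^0_\alpha$ sets, and, for $\alpha>1$, ${\bf\Sigma}^0_\alpha$ of the countable unions $\bigcup_{n}A_n$ with each $A_n$ in ${\bf\Pi}^0_{\beta_n}$ for some $1\leq\beta_n<\alpha$. A set $A$ is complete for a class $\mathcal{C}$ of subsets of $\mathbb{R}$ if $A\in\mathcal{C}$ and $B\leq A$ for all $B\in\mathcal{C}$. A subset of $\mathbb{R}$ is $D_2({\bf\Sigma}^0_1)$ if it is the intersection of an open and a closed set, and $\check{D}_2({\bf\Sigma}^0_1)$ if its complement is $D_2({\bf\Sigma}^0_1)$. Theorem. For every countable ordinal $\alpha\geq 2$, there is no ${\bf\Sigma}^0_\alpha$-complete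 and no ${\bf\Pi}^0_\alpha$-complete subset of $\mathbb{R}$. In fact, there is a family $\langle B_a\mid a\subseteq\omega\rangle$ of $D_2({\bf\Sigma}^0_1)$ subsets of $\mathbb{R}$ such that for every subset $B$ of $\mathbb{R}$, we have $B_a\leq B$ for only countably many $a\subseteq\omega$. Moreover, there is also such a family consisting of $\check{D}_2({\bf\Sigma}^0_1)$ subsets of $\mathbb{R}$. -/

import Mathlib

namespace RealWadge

/-- `A` is (continuously, or Wadge) reducible to `B`: there is a continuous self-map `f` of the space
with `x ∈ A ↔ f x ∈ B` for all `x`. -/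
def Reducible {X : Type*} [TopologicalSpace X] (A B : Set X) : Prop :=
  ∃ f : X → X, Continuous f ∧ ∀ x, x ∈ A ↔ f x ∈ B

/-- The additive classes of the boldface Borel hierarchy: the `Σ⁰₁` sets are the open sets, and
for `1 < α` the `Σ⁰_α` sets are the unions `⋃ n, A n` of sequences of sets such that every `A n` is
`Π⁰_β` (that is, `(A n)ᶜ` is `Σ⁰_β`) for some `1 ≤ β < α` that may depend on `n`. -/
inductive IsSigma {X : Type*} [TopologicalSpace X] : Ordinal.{0} → Set X → Prop
  | of_isOpen {A : Set X} (hA : IsOpen A) : IsSigma 1 A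
  | iUnion {α : Ordinal.{0}} (hα : 1 < α) (A : ℕ → Set X) (β : ℕ → Ordinal.{0})
      (hβ : ∀ n, 1 ≤ β n ∧ β n < α) (hA : ∀ n, IsSigma (β n) (A n)ᶜ) :
      IsSigma α (⋃ n, A n)

/-- The multiplicative classes of the Borel hierarchy: complements of `Σ⁰_α` sets. -/
def IsPi {X : Type*} [TopologicalSpace X] (α : Ordinal.{0}) (A : Set X) : Prop :=
  IsSigma α Aᶜ

/-- A set `A` is complete for a class `C` of subsets of a space (with respect to continuous
reducibility) if it belongs to `C` and every member of `C` is reducible to it. -/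
def IsComplete {X : Type*} [TopologicalSpace X] (C : Set X → Prop) (A : Set X) : Prop :=
  C A ∧ ∀ B, C B → Reducible B A

/-- `D₂(Σ⁰₁)` sets: intersections of an open and a closed set. -/
abbrev IsD2 {X : Type*} [TopologicalSpace X] (A : Set X) : Prop :=
  IsLocallyClosed A

/-- The dual class of `D₂(Σ⁰₁)`: complements of `D₂(Σ⁰₁)` sets. -/
def IsDualD2 {X : Type*} [TopologicalSpace X] (A : Set X) : Prop :=
  IsD2 Aᶜ

end RealWadge

namespace RealWadge

open Set Filter Topology

/-! ### Closed sets and locally closed sets in the Borel hierarchy -/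

/-! Block `n` of `blockSet a` is a run of open intervals, alternately inside and outside the set,
accumulating at `n + 1`; whether the first one is inside codes `n ∉ a`. Adjacent nodes differ in
membership, and a reduction `f` to `C` cannot turn back at a node (`map_node_lt_succ_succ`) or at
the end of a block (`map_node_zero_lt_one_succ`). So `f` is monotone on the nodes from `0` on,
increasing after reflecting `C` if necessary, and `C` repeats the alternating pattern along their
images. A rational strictly between the first two images then determines `a` from `C`
(`eq_of_mem_Ioo_map_node`), so only countably many `a` reduce to `C`. Since there are uncountably
many `a`, no class containing every `blockSet a` has a complete set. -/

theorem isSigma_iUnion_of_isClosed {X : Type*} [TopologicalSpace X] {α : Ordinal.{0}}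
    (hα : 2 ≤ α) {F : ℕ → Set X} (hF : ∀ n, IsClosed (F n)) : IsSigma α (⋃ n, F n) := by
  have h1 : (1 : Ordinal.{0}) < α := lt_of_lt_of_le one_lt_two hα
  exact IsSigma.iUnion h1 F (fun _ => 1) (fun _ => ⟨le_rfl, h1⟩)
    (fun n => IsSigma.of_isOpen (hF n).isOpen_compl)

theorem IsD2.isSigma {A : Set ℝ} (hA : IsD2 A) {α : Ordinal.{0}} (hα : 2 ≤ α) :
    IsSigma α A := by
  obtain ⟨U, Z, hU, hZ, rfl⟩ := hA
  obtain ⟨F, hF, -, rfl, -⟩ := hU.exists_iUnion_isClosed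
  rw [iUnion_inter]
  exact isSigma_iUnion_of_isClosed hα fun n => (hF n).inter hZ

theorem IsD2.isPi {A : Set ℝ} (hA : IsD2 A) {α : Ordinal.{0}} (hα : 2 ≤ α) :
    IsPi α A := by
  obtain ⟨U, Z, hU, hZ, rfl⟩ := hA
  obtain ⟨F, hF, -, hFZ, -⟩ := hZ.isOpen_compl.exists_iUnion_isClosed
  rw [IsPi, compl_inter, ← hFZ, union_iUnion]
  exact isSigma_iUnion_of_isClosed hα fun n => hU.isClosed_compl.union (hF n)

/-! ### Reducibility and symmetries -/

theorem reducible_compl_iff {X : Type*} [TopologicalSpace X] {A C : Set X} :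
    Reducible Aᶜ C ↔ Reducible A Cᶜ := by
  refine exists_congr fun f => and_congr_right fun _ => forall_congr' fun x => ?_
  simp only [mem_compl_iff]
  tauto

/-! ### The family of sets -/

/-- The order-preserving parametrization of each interval `[n, n + 1)` by `[1, ∞)`. -/
noncomputable def blockTime (x : ℝ) : ℝ := (1 - Int.fract x)⁻¹

/-- The set that consists, inside `[n, n + 1)`, of infinitely many half-open intervals
accumulating at `n + 1`; they contain their left endpoints if `n ∈ a` and their right endpoints
otherwise. -/
def blockSet (a : Set ℕ) : Set ℝ :=
  {x | (⌊x⌋.toNat ∈ a ∧ Even ⌊blockTime x⌋) ∨ (⌊x⌋.toNat ∉ a ∧ Even ⌈blockTime x⌉)}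

/-- The endpoints of the intervals in the `n`-th block. -/
noncomputable def node (n k : ℕ) : ℝ := n + 1 - ((k : ℝ) + 1)⁻¹

theorem node_zero (n : ℕ) : node n 0 = n := by simp [node]

theorem node_lt_succ (n k : ℕ) : node n k < node n (k + 1) := by
  unfold node
  have : ((k + 1 : ℕ) + 1 : ℝ)⁻¹ < ((k : ℝ) + 1)⁻¹ := by
    gcongr
    linarith
  linarith

theorem strictMono_node (n : ℕ) : StrictMono (node n) :=
  strictMono_nat_of_lt_succ (node_lt_succ n)

theorem natCast_le_node (n k : ℕ) : (n : ℝ) ≤ node n k :=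
  (node_zero n).symm.le.trans ((strictMono_node n).monotone k.zero_le)

theorem node_lt (n k : ℕ) : node n k < n + 1 := by
  unfold node
  have : (0 : ℝ) < ((k : ℝ) + 1)⁻¹ := by positivity
  linarith

theorem tendsto_node (n : ℕ) : Tendsto (node n) atTop (𝓝 ((n + 1 : ℕ) : ℝ)) := by
  have h := (tendsto_one_div_add_atTop_nhds_zero_nat (𝕜 := ℝ)).const_sub ((n : ℝ) + 1)
  rw [sub_zero] at h
  push_cast
  exact h.congr fun k => by rw [node, one_div]

theorem blockTime_eq {n : ℤ} {x : ℝ} (h : ⌊x⌋ = n) : blockTime x = (n + 1 - x)⁻¹ := by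
  rw [blockTime, Int.fract, h]
  congr 1
  ring

theorem floor_of_mem_Ico {n : ℕ} {x : ℝ} (h1 : (n : ℝ) ≤ x) (h2 : x < n + 1) : ⌊x⌋ = n :=
  Int.floor_eq_iff.2 ⟨by exact_mod_cast h1, by exact_mod_cast h2⟩

/-- At a node floor and ceiling agree, so membership does not depend on `a`; only the open intervals
between nodes carry the code. -/
theorem node_mem_blockSet_iff (a : Set ℕ) (n k : ℕ) : node n k ∈ blockSet a ↔ ¬ Even k := by
  have hf := floor_of_mem_Ico (natCast_le_node n k) (node_lt n k)
  have ht : blockTime (node n k) = ((k + 1 : ℤ) : ℝ) := by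
    rw [blockTime_eq hf]
    simp [node]
  have he : Even (k + 1 : ℤ) ↔ ¬ Even k := by
    rw [Int.even_add_one]
    simp
  simp only [blockSet, mem_ofPred_eq, ht, Int.floor_intCast, Int.ceil_intCast, he]
  tauto

theorem mem_blockSet_iff_of_mem_Ioo (a : Set ℕ) {n k : ℕ} {x : ℝ}
    (hx : x ∈ Ioo (node n k) (node n (k + 1))) : x ∈ blockSet a ↔ (Even k ↔ n ∉ a) := by
  have hn : x < n + 1 := hx.2.trans (node_lt n _)
  have hf := floor_of_mem_Ico ((natCast_le_node n k).trans hx.1.le) hn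
  have hpos : 0 < (n : ℝ) + 1 - x := by linarith
  have h1 : (k : ℝ) + 1 < (n + 1 - x)⁻¹ := by
    rw [lt_inv_comm₀ (by positivity) hpos]
    have := hx.1
    unfold node at this
    linarith
  have h2 : (n + 1 - x)⁻¹ < (k : ℝ) + 2 := by
    rw [inv_lt_comm₀ hpos (by positivity)]
    have := hx.2
    unfold node at this
    push_cast at this
    rw [show (k : ℝ) + 1 + 1 = k + 2 by ring] at this
    linarith
  have hfl : ⌊blockTime x⌋ = (k : ℤ) + 1 := by
    rw [blockTime_eq hf, Int.floor_eq_iff]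
    push_cast
    constructor <;> linarith
  have hce : ⌈blockTime x⌉ = (k : ℤ) + 1 + 1 := by
    rw [blockTime_eq hf, Int.ceil_eq_iff]
    push_cast
    constructor <;> linarith
  have he : Even (k : ℤ) ↔ Even k := by simp
  simp only [blockSet, mem_ofPred_eq, hf, hfl, hce, Int.toNat_natCast, Int.even_add_one, he]
  tauto

theorem isOpen_Ioo_inter_blockTime (n : ℤ) (p q : ℝ) :
    IsOpen (Ioo (n : ℝ) (n + 1) ∩ blockTime ⁻¹' Ioo p q) := by
  have hc : ContinuousOn (fun x : ℝ => ((n : ℝ) + 1 - x)⁻¹) (Ioo (n : ℝ) (n + 1)) :=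
    (continuousOn_const.sub continuousOn_id).inv₀ fun x hx => (sub_pos.2 hx.2).ne'
  exact (hc.congr fun x hx => blockTime_eq (Int.floor_eq_iff.2 ⟨hx.1.le, hx.2⟩)).isOpen_inter_preimage
    isOpen_Ioo isOpen_Ioo

theorem blockTime_intCast (n : ℤ) : blockTime n = 1 := by simp [blockTime]

theorem isD2_blockSet (a : Set ℕ) : IsD2 (blockSet a) := by
  refine ((isLocallyClosed_tfae (blockSet a)).out 0 3).2 fun x hx => ?_
  have hfl : ∀ {n : ℤ} {y : ℝ}, y ∈ Ioo (n : ℝ) (n + 1) → ⌊y⌋ = n := fun h =>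
    Int.floor_eq_iff.2 ⟨h.1.le, h.2⟩
  have hxI : x ∈ Ioo (⌊x⌋ : ℝ) (⌊x⌋ + 1) := by
    refine ⟨(Int.floor_le x).lt_of_ne fun h => ?_, Int.lt_floor_add_one x⟩
    -- An integer has block time 1, which is odd, so it is not in the set.
    rw [blockSet, mem_ofPred_eq, ← h, blockTime_intCast] at hx
    simp at hx
  generalize ⌊x⌋ = n at hxI
  by_cases hn : n.toNat ∈ a
  · have hA : ∀ y ∈ Ioo (n : ℝ) (n + 1), y ∈ blockSet a ↔ Even ⌊blockTime y⌋ := fun y hy => by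
      simp [blockSet, hfl hy, hn]
    have hm := (hA x hxI).1 hx
    have h1 := Int.floor_le (blockTime x)
    have h2 := Int.lt_floor_add_one (blockTime x)
    generalize ⌊blockTime x⌋ = m at hm h1 h2
    -- In this window the set is exactly the part with block time at least `m`, which is relatively
    -- closed.
    refine ⟨Ioo (n : ℝ) (n + 1) ∩ blockTime ⁻¹' Ioo (m - 1 : ℝ) (m + 1), ⟨hxI, ⟨(sub_one_lt _).trans_le h1, h2⟩⟩,
      isOpen_Ioo_inter_blockTime n (m - 1) (m + 1), ?_⟩
    rintro y ⟨⟨hyI, hy1, hy2⟩, hyA⟩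
    rcases le_or_gt (m : ℝ) (blockTime y) with h | h
    · rwa [hA y hyI, Int.floor_eq_iff.2 ⟨h, hy2⟩]
    · obtain ⟨z, ⟨hzI, hz1, hz2⟩, hzA⟩ := mem_closure_iff.1 hyA _
        (isOpen_Ioo_inter_blockTime n (m - 1) m) ⟨hyI, hy1, h⟩
      have hz : ⌊blockTime z⌋ = m - 1 :=
        Int.floor_eq_iff.2 ⟨by push_cast; exact hz1.le, by push_cast; linarith⟩
      rw [hA z hzI, hz, Int.even_sub_one] at hzA
      exact absurd hm hzA
  · have hA : ∀ y ∈ Ioo (n : ℝ) (n + 1), y ∈ blockSet a ↔ Even ⌈blockTime y⌉ := fun y hy => by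
      simp [blockSet, hfl hy, hn]
    have hm := (hA x hxI).1 hx
    have h1 := Int.le_ceil (blockTime x)
    have h2 := Int.ceil_lt_add_one (blockTime x)
    generalize ⌈blockTime x⌉ = m at hm h1 h2
    refine ⟨Ioo (n : ℝ) (n + 1) ∩ blockTime ⁻¹' Ioo (m - 1 : ℝ) (m + 1), ⟨hxI, ⟨by linarith, h1.trans_lt (lt_add_one _)⟩⟩,
      isOpen_Ioo_inter_blockTime n (m - 1) (m + 1), ?_⟩
    rintro y ⟨⟨hyI, hy1, hy2⟩, hyA⟩
    rcases le_or_gt (blockTime y) (m : ℝ) with h | h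
    · rwa [hA y hyI, Int.ceil_eq_iff.2 ⟨hy1, h⟩]
    · obtain ⟨z, ⟨hzI, hz1, hz2⟩, hzA⟩ := mem_closure_iff.1 hyA _
        (isOpen_Ioo_inter_blockTime n m (m + 1)) ⟨hyI, h, hy2⟩
      have hz : ⌈blockTime z⌉ = m + 1 :=
        Int.ceil_eq_iff.2 ⟨by push_cast; linarith, by push_cast; exact hz2.le⟩
      rw [hA z hzI, hz, Int.even_add_one] at hzA
      exact absurd hm hzA

/-! ### Reductions are monotone on the nodes -/

section Reduction

variable {a : Set ℕ} {C : Set ℝ} {f : ℝ → ℝ}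

theorem node_ne_succ (hC : ∀ x, x ∈ blockSet a ↔ f x ∈ C) (n k : ℕ) :
    f (node n k) ≠ f (node n (k + 1)) := by
  intro h
  have h1 := node_mem_blockSet_iff a n k
  have h2 := node_mem_blockSet_iff a n (k + 1)
  rw [hC, Nat.even_add_one] at h2
  rw [hC, h] at h1
  tauto

theorem mem_iff_of_mem_image (hC : ∀ x, x ∈ blockSet a ↔ f x ∈ C) {n k : ℕ} {y : ℝ}
    (hy : y ∈ f '' Ioo (node n k) (node n (k + 1))) : y ∈ C ↔ (Even k ↔ n ∉ a) := by
  obtain ⟨x, hx, rfl⟩ := hy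
  rw [← hC, mem_blockSet_iff_of_mem_Ioo a hx]

theorem Ioo_subset_image (hf : Continuous f) (n k : ℕ) :
    Ioo (f (node n k)) (f (node n (k + 1))) ⊆ f '' Ioo (node n k) (node n (k + 1)) :=
  intermediate_value_Ioo (node_lt_succ n k).le hf.continuousOn

theorem Ioo_subset_image' (hf : Continuous f) (n k : ℕ) :
    Ioo (f (node n (k + 1))) (f (node n k)) ⊆ f '' Ioo (node n k) (node n (k + 1)) :=
  intermediate_value_Ioo' (node_lt_succ n k).le hf.continuousOn

/-- If `f` turned back, values just below the peak would be attained on both adjacent intervals,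
whose colors are opposite. -/
theorem map_node_lt_succ_succ (hf : Continuous f) (hC : ∀ x, x ∈ blockSet a ↔ f x ∈ C)
    {n k : ℕ} (h : f (node n k) < f (node n (k + 1))) :
    f (node n (k + 1)) < f (node n (k + 1 + 1)) := by
  by_contra! hle
  have hlt := hle.lt_of_ne (node_ne_succ hC n (k + 1)).symm
  obtain ⟨y, hy1, hy2⟩ := exists_between (max_lt h hlt)
  rw [max_lt_iff] at hy1
  have e1 := mem_iff_of_mem_image hC (Ioo_subset_image hf n k ⟨hy1.1, hy2⟩)
  have e2 := mem_iff_of_mem_image hC (Ioo_subset_image' hf n (k + 1) ⟨hy1.2, hy2⟩)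
  rw [Nat.even_add_one] at e2
  tauto

theorem strictMono_map_node_of_lt (hf : Continuous f) (hC : ∀ x, x ∈ blockSet a ↔ f x ∈ C)
    {n : ℕ} (h : f (node n 0) < f (node n 1)) : StrictMono fun k => f (node n k) := by
  refine strictMono_nat_of_lt_succ fun k => ?_
  induction k with
  | zero => exact h
  | succ k ih => exact map_node_lt_succ_succ hf hC ih

theorem tendsto_map_node (hf : Continuous f) (n : ℕ) :
    Tendsto (fun k => f (node n k)) atTop (𝓝 (f (node (n + 1) 0))) := by
  rw [node_zero]
  exact (hf.tendsto _).comp (tendsto_node n)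

/-- If `f` turned back at `n + 1`, the first interval of the next block, which has one color, would
attain the values at all late nodes of block `n`, whose membership alternates. -/
theorem map_node_zero_lt_one_succ (hf : Continuous f) (hC : ∀ x, x ∈ blockSet a ↔ f x ∈ C)
    {n : ℕ} (h : f (node n 0) < f (node n 1)) :
    f (node (n + 1) 0) < f (node (n + 1) 1) := by
  by_contra! hle
  have hlt := hle.lt_of_ne (node_ne_succ hC (n + 1) 0).symm
  have hmono := strictMono_map_node_of_lt hf hC h
  have hlim := tendsto_map_node hf n
  obtain ⟨k, hk⟩ := (hlim.eventually (lt_mem_nhds hlt)).exists_forall_of_atTop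
  have key : ∀ j, k ≤ j → (¬ Even j ↔ (Even 0 ↔ n + 1 ∉ a)) := fun j hj => by
    rw [← node_mem_blockSet_iff a n j, hC]
    refine mem_iff_of_mem_image hC (Ioo_subset_image' hf (n + 1) 0 ⟨hk j hj, ?_⟩)
    exact (hmono j.lt_succ_self).trans_le (hmono.monotone.ge_of_tendsto hlim _)
  have e1 := key k le_rfl
  have e2 := key (k + 1) k.le_succ
  rw [Nat.even_add_one] at e2
  tauto

theorem map_node_zero_lt_one (hf : Continuous f) (hC : ∀ x, x ∈ blockSet a ↔ f x ∈ C)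
    (h : f (node 0 0) < f (node 0 1)) (n : ℕ) : f (node n 0) < f (node n 1) := by
  induction n with
  | zero => exact h
  | succ n ih => exact map_node_zero_lt_one_succ hf hC ih

end Reduction

/-! ### Decoding -/

/-- The set `C` alternates along the increasing sequence `u`, starting with the color `E`. -/
def Alternates (C : Set ℝ) (u : ℕ → ℝ) (E : Prop) : Prop :=
  StrictMono u ∧ ∀ k, ∀ y ∈ Ioo (u k) (u (k + 1)), (y ∈ C ↔ (Even k ↔ E))

/-- Otherwise points just above `u (k + 1)` would have color `k + 1` along `u` but still color `k`
along `v`. -/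
theorem Alternates.le_of_mem {C : Set ℝ} {u v : ℕ → ℝ} {E : Prop} (hu : Alternates C u E)
    (hv : Alternates C v E) {k : ℕ} {q : ℝ} (hqu : q < u (k + 1))
    (hqv : q ∈ Ioo (v k) (v (k + 1))) : v (k + 1) ≤ u (k + 1) := by
  by_contra! hlt
  obtain ⟨y, hy1, hy2⟩ := exists_between (lt_min (hu.1 (k + 1).lt_succ_self) hlt)
  rw [lt_min_iff] at hy2
  have e1 := hu.2 (k + 1) y ⟨hy1, hy2.1⟩
  have e2 := hv.2 k y ⟨hqv.1.trans (hqu.trans hy1), hy2.2⟩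
  rw [Nat.even_add_one] at e1
  tauto

theorem Alternates.eq_of_mem {C : Set ℝ} {u v : ℕ → ℝ} {E E' : Prop} (hu : Alternates C u E)
    (hv : Alternates C v E') {q : ℝ} (hqu : q ∈ Ioo (u 0) (u 1)) (hqv : q ∈ Ioo (v 0) (v 1)) :
    (E ↔ E') ∧ ∀ k, u (k + 1) = v (k + 1) := by
  have hE : E ↔ E' := by
    have e1 := hu.2 0 q hqu
    have e2 := hv.2 0 q hqv
    simp only [Even.zero, true_iff] at e1 e2
    rw [← e1, e2]
  have hE' : E = E' := propext hE
  subst hE'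
  refine ⟨Iff.rfl, fun k => ?_⟩
  have step : ∀ {k : ℕ} {q : ℝ}, q ∈ Ioo (u k) (u (k + 1)) → q ∈ Ioo (v k) (v (k + 1)) →
      u (k + 1) = v (k + 1) := fun h1 h2 =>
    le_antisymm (hv.le_of_mem hu h2.2 h1) (hu.le_of_mem hv h1.2 h2)
  induction k with
  | zero => exact step hqu hqv
  | succ k ih =>
    obtain ⟨y, hy1, hy2⟩ :=
      exists_between (lt_min (hu.1 (k + 1).lt_succ_self) (ih.trans_lt (hv.1 (k + 1).lt_succ_self)))
    rw [lt_min_iff] at hy2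
    exact step ⟨hy1, hy2.1⟩ ⟨ih ▸ hy1, hy2.2⟩

theorem alternates_map_node {a : Set ℕ} {C : Set ℝ} {f : ℝ → ℝ} (hf : Continuous f)
    (hC : ∀ x, x ∈ blockSet a ↔ f x ∈ C) (h : f (node 0 0) < f (node 0 1)) (n : ℕ) :
    Alternates C (fun k => f (node n k)) (n ∉ a) :=
  ⟨strictMono_map_node_of_lt hf hC (map_node_zero_lt_one hf hC h n),
    fun k _ hy => mem_iff_of_mem_image hC (Ioo_subset_image hf n k hy)⟩

/-- Overlapping first intervals force the image nodes from index 1 on to agree, hence also their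
limits, where the next blocks start; so the first intervals overlap in every block. -/
theorem eq_of_mem_Ioo_map_node {a b : Set ℕ} {C : Set ℝ} {f g : ℝ → ℝ} (hf : Continuous f)
    (hg : Continuous g) (hfC : ∀ x, x ∈ blockSet a ↔ f x ∈ C)
    (hgC : ∀ x, x ∈ blockSet b ↔ g x ∈ C) {q : ℝ}
    (hqf : q ∈ Ioo (f (node 0 0)) (f (node 0 1)))
    (hqg : q ∈ Ioo (g (node 0 0)) (g (node 0 1))) : a = b := by
  have hu := alternates_map_node hf hfC (hqf.1.trans hqf.2)
  have hv := alternates_map_node hg hgC (hqg.1.trans hqg.2)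
  have common : ∀ n, ∃ q, q ∈ Ioo (f (node n 0)) (f (node n 1)) ∧
      q ∈ Ioo (g (node n 0)) (g (node n 1)) := by
    intro n
    induction n with
    | zero => exact ⟨q, hqf, hqg⟩
    | succ n ih =>
      obtain ⟨q, h1, h2⟩ := ih
      have heq := ((hu n).eq_of_mem (hv n) h1 h2).2
      have hlim : f (node (n + 1) 0) = g (node (n + 1) 0) :=
        tendsto_nhds_unique
          (((tendsto_map_node hf n).comp (tendsto_add_atTop_nat 1)).congr heq)
          ((tendsto_map_node hg n).comp (tendsto_add_atTop_nat 1))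
      obtain ⟨y, hy1, hy2⟩ := exists_between
        (lt_min ((hu (n + 1)).1 one_pos) (hlim.trans_lt ((hv (n + 1)).1 one_pos)))
      rw [lt_min_iff] at hy2
      exact ⟨y, ⟨hy1, hy2.1⟩, ⟨hlim ▸ hy1, hy2.2⟩⟩
  ext n
  obtain ⟨q, h1, h2⟩ := common n
  exact not_iff_not.1 ((hu n).eq_of_mem (hv n) h1 h2).1

theorem countable_setOf_increasing_reduction (C : Set ℝ) :
    {a : Set ℕ | ∃ f : ℝ → ℝ, Continuous f ∧ (∀ x, x ∈ blockSet a ↔ f x ∈ C) ∧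
      f (node 0 0) < f (node 0 1)}.Countable := by
  have hq : ∀ a ∈ {a : Set ℕ | ∃ f : ℝ → ℝ, Continuous f ∧ (∀ x, x ∈ blockSet a ↔ f x ∈ C) ∧
      f (node 0 0) < f (node 0 1)}, ∃ q : ℚ, ∃ f : ℝ → ℝ, Continuous f ∧
      (∀ x, x ∈ blockSet a ↔ f x ∈ C) ∧ (q : ℝ) ∈ Ioo (f (node 0 0)) (f (node 0 1)) := by
    rintro a ⟨f, hf, hC, h⟩
    obtain ⟨q, h1, h2⟩ := exists_rat_btwn h
    exact ⟨q, f, hf, hC, h1, h2⟩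
  choose! q hq using hq
  refine (mapsTo_univ q _).countable_of_injOn (fun a ha b hb hab => ?_) (to_countable univ)
  obtain ⟨f, hf, hfC, hqf⟩ := hq a ha
  obtain ⟨g, hg, hgC, hqg⟩ := hq b hb
  rw [← hab] at hqg
  exact eq_of_mem_Ioo_map_node hf hg hfC hgC hqf hqg

theorem countable_setOf_reducible_blockSet (C : Set ℝ) :
    {a : Set ℕ | Reducible (blockSet a) C}.Countable := by
  refine ((countable_setOf_increasing_reduction C).union
    (countable_setOf_increasing_reduction {y | -y ∈ C})).mono ?_
  rintro a ⟨f, hf, hC⟩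
  rcases (node_ne_succ hC 0 0).lt_or_gt with h | h
  · exact Or.inl ⟨f, hf, hC, h⟩
  · exact Or.inr ⟨fun x => -f x, hf.neg, by simpa using hC, neg_lt_neg h⟩

theorem not_isComplete_of_forall_blockSet {P : Set ℝ → Prop} (hP : ∀ a, P (blockSet a)) :
    ¬ ∃ A, IsComplete P A := by
  rintro ⟨A, -, hA⟩
  have h := countable_setOf_reducible_blockSet A
  rw [eq_univ_of_forall (s := {a : Set ℕ | Reducible (blockSet a) A})
    fun a => hA _ (hP a)] at h
  have := countable_univ_iff.1 h
  obtain ⟨g, hg⟩ := exists_injective_nat (Set ℕ)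
  exact Function.cantor_injective g hg

end RealWadge

theorem mainTheorem3 :
    (∀ α : Ordinal.{0}, 2 ≤ α → α.card ≤ Cardinal.aleph0 →
      (¬ ∃ A : Set ℝ, RealWadge.IsComplete (RealWadge.IsSigma α) A) ∧
      (¬ ∃ A : Set ℝ, RealWadge.IsComplete (RealWadge.IsPi α) A)) ∧
    (∃ B : Set ℕ → Set ℝ, (∀ a, RealWadge.IsD2 (B a)) ∧
      ∀ C : Set ℝ, {a : Set ℕ | RealWadge.Reducible (B a) C}.Countable) ∧
    (∃ B : Set ℕ → Set ℝ, (∀ a, RealWadge.IsDualD2 (B a)) ∧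
      ∀ C : Set ℝ, {a : Set ℕ | RealWadge.Reducible (B a) C}.Countable) := by
  refine ⟨fun α hα _ => ⟨?_, ?_⟩, ?_, ?_⟩
  · exact RealWadge.not_isComplete_of_forall_blockSet fun a =>
      RealWadge.IsD2.isSigma (RealWadge.isD2_blockSet a) hα
  · exact RealWadge.not_isComplete_of_forall_blockSet fun a =>
      RealWadge.IsD2.isPi (RealWadge.isD2_blockSet a) hα
  · exact ⟨RealWadge.blockSet, RealWadge.isD2_blockSet,
      RealWadge.countable_setOf_reducible_blockSet⟩
  · refine ⟨fun a => (RealWadge.blockSet a)ᶜ, fun a => ?_, fun C => ?_⟩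
    · rw [RealWadge.IsDualD2, compl_compl]
      exact RealWadge.isD2_blockSet a
    · simp only [RealWadge.reducible_compl_iff]
      exact RealWadge.countable_setOf_reducible_blockSet Cᶜ
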